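/- **Theorem 1.** There is an absolute constant $C_0>0$ with the following property. Let $n,r\ge 1$, let the nodes $[n]=\{1,\dots,n\}$ be partitioned into clusters $C_1^*,\dots,C_r^*$ (empty clusters are allowed), let $\theta\in[0,1]^n$ with $\max_i\theta_i=1$, and let $B\in\mathbb R^{r\times r}$ be symmetric with nonnegative entries such that $\theta_i\theta_jB_{ab}\le 1$ for all $i\in C_a^*$, $j\in C_b^*$ (including $i=j$). Let $A$ be the adjacency matrix of a random simple graph on $[n]$ in which each pair of distinct nodes $i\in C_a^*$, $j\in C_b^*$ is joined by an edge with probability $\theta_i\theta_jB_{ab}$, independently over all pairs, and let $d_i=\sum_jA_{ij}$ be its degrees. Put $$G_a=\sum_{i\in C_a^*}\theta_i,\qquad H_a=\sum_{b=1}^rB_{ab}G_b,\qquad f_i=\theta_iH_a\ \ (i\in C_a^*),\qquad \|Z\|_{1,\theta}=\sum_{i,j}|\theta_iZ_{ij}\theta_j|,$$ and let $Y^*_{ij}=1$ if $i,j$ lie in the same cluster and $Y^*_{ij}=0$ otherwise. Assume that $$\max_{a<b}\frac{B_{ab}}{H_aH_b}<\min_a\frac{B_{aa}}{H_a^2},$$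 and that $\lambda>0$ and $\delta>0$ satisfy $$\max_{a<b}\frac{B_{ab}+\delta}{H_aH_b}<\lambda<\min_a\frac{B_{aa}-\delta}{H_a^2}$$ (conditions on pairs $a<b$ are void if $r=1$; the second condition presupposes $H_a>0$ for all $a$). Then, with probability at least $0.99-2(e/2)^{-2n}$, every optimal solution $\widehat Y$ of the semidefinite program $$\max_Y\ \langle Y,\,A-\lambda dd^\top\rangle\quad\text{subject to}\quad Y\succeq 0,\quad 0\le Y_{ij}\le 1,\quad Y_{ii}=1\quad(i,j\in[n])$$ satisfies $$\|Y^*-\widehat Y\|_{1,\theta}\le\frac{C_0}{\delta}\Bigl(1+\min_{a}\frac{B_{aa}}{H_a^2}\,\|f\|_1\Bigr)\bigl(\sqrt{n\|f\|_1}+n\bigr).$$ -/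

import Mathlib

open MeasureTheory ProbabilityTheory

namespace DCSBM

noncomputable section

/-- `G_a = ∑_{i ∈ C_a} θ_i`, where `c i` is the label of the cluster that contains node `i`. -/
def clusterWeight {n r : ℕ} (θ : Fin n → ℝ) (c : Fin n → Fin r) (a : Fin r) : ℝ :=
  ∑ i with c i = a, θ i

/-- `H_a = ∑_b B_{ab} G_b`. -/
def clusterDegree {n r : ℕ} (θ : Fin n → ℝ) (c : Fin n → Fin r)
    (B : Matrix (Fin r) (Fin r) ℝ) (a : Fin r) : ℝ :=
  ∑ b, B a b * clusterWeight θ c b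

/-- `f_i = θ_i H_a` for a node `i` in cluster `a`. -/
def nodeDegree {n r : ℕ} (θ : Fin n → ℝ) (c : Fin n → Fin r)
    (B : Matrix (Fin r) (Fin r) ℝ) (i : Fin n) : ℝ :=
  θ i * clusterDegree θ c B (c i)

/-- The `ℓ₁` norm of a vector. -/
def l1Norm {n : ℕ} (v : Fin n → ℝ) : ℝ := ∑ i, |v i|

/-- The weighted element-wise `ℓ₁` norm `∑_{i,j} |θ_i Z_{ij} θ_j|`. -/
def weightedL1Norm {n : ℕ} (θ : Fin n → ℝ) (Z : Matrix (Fin n) (Fin n) ℝ) : ℝ :=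
  ∑ i, ∑ j, |θ i * Z i j * θ j|

/-- The partition matrix of the clustering `c`. -/
def partitionMatrix {n r : ℕ} (c : Fin n → Fin r) : Matrix (Fin n) (Fin n) ℝ :=
  Matrix.of fun i j => if c i = c j then 1 else 0

/-- Admissible parameters of a degree-corrected stochastic block model: nonnegative degree
heterogeneity parameters with maximum one, a symmetric nonnegative connectivity matrix, and
`θ_i θ_j B_{ab} ≤ 1` for all nodes `i ∈ C_a`, `j ∈ C_b` (including `i = j`). -/
structure IsParam {n r : ℕ} (θ : Fin n → ℝ) (c : Fin n → Fin r)
    (B : Matrix (Fin r) (Fin r) ℝ) : Prop where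
  theta_nonneg : ∀ i, 0 ≤ θ i
  theta_le_one : ∀ i, θ i ≤ 1
  exists_theta_eq_one : ∃ i, θ i = 1
  B_symm : B.IsSymm
  B_nonneg : ∀ a b, 0 ≤ B a b
  prob_le_one : ∀ i j, θ i * θ j * B (c i) (c j) ≤ 1

/-- The random graph `G` is drawn from the degree-corrected stochastic block model: distinct nodes
`i ∈ C_a`, `j ∈ C_b` are adjacent with probability `θ_i θ_j B_{ab}`, and the edge events of the
unordered pairs of distinct nodes are mutually independent. -/
structure IsRandomGraph {n r : ℕ} (θ : Fin n → ℝ) (c : Fin n → Fin r)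
    (B : Matrix (Fin r) (Fin r) ℝ) {Ω : Type*} [MeasurableSpace Ω] (μ : Measure Ω)
    (G : Ω → SimpleGraph (Fin n)) : Prop where
  measurableSet_adj : ∀ i j, MeasurableSet {ω | (G ω).Adj i j}
  prob_adj : ∀ i j, i ≠ j → μ.real {ω | (G ω).Adj i j} = θ i * θ j * B (c i) (c j)
  indep : iIndepSet
    (fun e : {e : Fin n × Fin n // e.1 < e.2} => {ω | (G ω).Adj e.1.1 e.1.2}) μ

/-- The degree-corrected density gap condition
`max_{a < b} B_{ab} / (H_a H_b) < min_a B_{aa} / H_a²`. -/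
def DensityGap {n r : ℕ} (θ : Fin n → ℝ) (c : Fin n → Fin r)
    (B : Matrix (Fin r) (Fin r) ℝ) : Prop :=
  ∀ a b k : Fin r, a < b →
    B a b / (clusterDegree θ c B a * clusterDegree θ c B b) < B k k / clusterDegree θ c B k ^ 2

open Classical in
/-- The adjacency matrix of a graph on `n` nodes. -/
def adjacency {n : ℕ} (G : SimpleGraph (Fin n)) : Matrix (Fin n) (Fin n) ℝ :=
  G.adjMatrix ℝ

/-- The degree vector `d_i = ∑_j A_{ij}`. -/
def degreeVec {n : ℕ} (A : Matrix (Fin n) (Fin n) ℝ) (i : Fin n) : ℝ := ∑ j, A i j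

/-- The feasible set of the semidefinite program:
`Y ⪰ 0`, `0 ≤ Y_{ij} ≤ 1` and `Y_{ii} = 1`. -/
def feasibleSet (n : ℕ) : Set (Matrix (Fin n) (Fin n) ℝ) :=
  {Y | Y.PosSemidef ∧ (∀ i j, 0 ≤ Y i j ∧ Y i j ≤ 1) ∧ ∀ i, Y i i = 1}

/-- The objective `⟨Y, A - lam d dᵀ⟩` (trace inner product). -/
def objective {n : ℕ} (A : Matrix (Fin n) (Fin n) ℝ) (lam : ℝ)
    (Y : Matrix (Fin n) (Fin n) ℝ) : ℝ :=
  ∑ i, ∑ j, Y i j * (A i j - lam * (degreeVec A i * degreeVec A j))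

/-- `Y` is an optimal solution of the semidefinite program. -/
def IsSolution {n : ℕ} (A : Matrix (Fin n) (Fin n) ℝ) (lam : ℝ)
    (Y : Matrix (Fin n) (Fin n) ℝ) : Prop :=
  Y ∈ feasibleSet n ∧ IsMaxOn (objective A lam) (feasibleSet n) Y

end

end DCSBM

/-! Write Z for the partition matrix, P for `edgeProb`, f for `nodeDegree` and W for the
off-diagonal noise. The gap conditions make every entry of (Z - Y) ∘ (P - lam f fᵀ) at least δ θ_i
θ_j |Z_ij - Y_ij| (`mul_abs_le_of_gap`), so δ times the weighted error is at most ⟨Z - Y, P - lam f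
fᵀ⟩. Replacing P and f by A and d, optimality of Y makes the resulting difference of objectives
nonpositive. Two errors remain: ⟨Y - Z, W⟩ and lam ⟨Z - Y, d dᵀ - f fᵀ⟩.

Both are controlled by one quantity, the maximum T of ∑ s_i t_j W_ij over sign vectors.
Grothendieck's inequality (`SignBound.abs_sum_mul_posSemidef_le`) bounds |⟨Y, W⟩| by 96 T uniformly
in feasible Y. Suitable signs also give ‖d - f‖₁ ≤ T + n, and ‖d‖₁ + ‖f‖₁ multiplies this in the
second error.

The probability enters twice. Chernoff and a union bound over 4^n sign pairs give T ≤ `radius`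
(`measureReal_not_signBound_le`); Markov gives ‖d‖₁ ≤ 100 ‖f‖₁ outside an event of probability at
most 0.01. -/

namespace DCSBM

/-! ### Grothendieck's inequality by truncating Rademacher sums. -/

/-- Rademacher variables on a finite uniform probability space: isometry and fourth moment bound. -/
theorem exists_rademacher (m : ℕ) :
    ∃ (Ω : Type) (_ : Fintype Ω) (e : Fin m → Ω → ℝ) (w : ℝ), 0 < w ∧ w * Fintype.card Ω = 1 ∧
      ∀ u : Fin m → ℝ, w * ∑ x, (∑ k, u k * e k x) ^ 2 = ∑ k, u k ^ 2 ∧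
        w * ∑ x, (∑ k, u k * e k x) ^ 4 ≤ 3 * (∑ k, u k ^ 2) ^ 2 := by
  induction m with
  | zero => exact ⟨Unit, inferInstance, fun _ _ => 0, 1, by norm_num, by simp, fun u => by simp⟩
  | succ m ih =>
    obtain ⟨Ω, _, e, w, hw, hc, he⟩ := ih
    -- Two copies of the old space at half the weight: the new sign is +1 on one copy and -1 on the
    -- other, so it is independent of the old ones and odd cross terms cancel.
    refine ⟨Ω ⊕ Ω, inferInstance,
      Fin.cons (Sum.elim (fun _ => 1) (fun _ => -1)) (fun k => Sum.elim (e k) (e k)), w / 2,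
      by positivity, by simp only [Fintype.card_sum, Nat.cast_add]; linarith, fun u => ?_⟩
    obtain ⟨h2, h4⟩ := he (fun k => u k.succ)
    simp only [Fintype.sum_sum_type, Fin.sum_univ_succ, Fin.cons_zero, Fin.cons_succ, Sum.elim_inl,
      Sum.elim_inr, ← Finset.sum_add_distrib]
    have hconst (a : ℝ) : w * ∑ _x : Ω, a = a := by
      rw [Finset.sum_const, Finset.card_univ, nsmul_eq_mul, ← mul_assoc, hc, one_mul]
    set X : Ω → ℝ := fun x => ∑ k : Fin m, u k.succ * e k x with hX
    set N := ∑ k : Fin m, u k.succ ^ 2 with hN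
    have hN0 : 0 ≤ N := Finset.sum_nonneg fun _ _ => sq_nonneg _
    constructor
    · have : ∀ x, (u 0 * 1 + X x) ^ 2 + (u 0 * -1 + X x) ^ 2 = 2 * u 0 ^ 2 + 2 * X x ^ 2 := by
        intro x; ring
      have h := hconst (2 * u 0 ^ 2)
      change w / 2 * ∑ x, ((u 0 * 1 + X x) ^ 2 + (u 0 * -1 + X x) ^ 2) = _
      simp only [this, Finset.sum_add_distrib, ← Finset.mul_sum (a := (2 : ℝ)) (f := fun x => X x ^ 2)]
      change w * ∑ x, X x ^ 2 = _ at h2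
      rw [← h2]; linarith
    · have : ∀ x, (u 0 * 1 + X x) ^ 4 + (u 0 * -1 + X x) ^ 4
          = 2 * u 0 ^ 4 + 12 * u 0 ^ 2 * X x ^ 2 + 2 * X x ^ 4 := by
        intro x; ring
      have h := hconst (2 * u 0 ^ 4)
      change w / 2 * ∑ x, ((u 0 * 1 + X x) ^ 4 + (u 0 * -1 + X x) ^ 4) ≤ _
      simp only [this, Finset.sum_add_distrib, ← Finset.mul_sum (f := fun x => X x ^ 2),
        ← Finset.mul_sum (f := fun x => X x ^ 4)]
      change w * ∑ x, X x ^ 2 = _ at h2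
      change w * ∑ x, X x ^ 4 ≤ _ at h4
      have e1 : w / 2 * (∑ _x : Ω, 2 * u 0 ^ 4 + 12 * u 0 ^ 2 * ∑ x, X x ^ 2 + 2 * ∑ x, X x ^ 4)
          = (w * ∑ _x : Ω, 2 * u 0 ^ 4) / 2 + 6 * u 0 ^ 2 * (w * ∑ x, X x ^ 2)
            + w * ∑ x, X x ^ 4 := by ring
      rw [e1, h, h2]
      nlinarith [sq_nonneg (u 0 ^ 2)]

section Grothendieck

variable {n : ℕ} {W : Matrix (Fin n) (Fin n) ℝ} {S T : ℝ}

/-- The cut-type norm of `W` is at most `T`. -/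
def SignBound (W : Matrix (Fin n) (Fin n) ℝ) (T : ℝ) : Prop :=
  ∀ s t : Fin n → Bool,
    ∑ i, ∑ j, (if s i then 1 else -1) * (if t j then 1 else -1) * W i j ≤ T

/-- The bilinear form of `W` on unit vectors of Euclidean spaces is at most `S`. -/
def GramBound (W : Matrix (Fin n) (Fin n) ℝ) (S : ℝ) : Prop :=
  ∀ (m : ℕ) (u v : Fin n → Fin m → ℝ), (∀ i, ∑ k, u i k ^ 2 ≤ 1) → (∀ i, ∑ k, v i k ^ 2 ≤ 1) →
    ∑ i, ∑ j, W i j * ∑ k, u i k * v j k ≤ S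

theorem exists_sign_mul_le {M : ℝ} (g x : Fin n → ℝ) (hx : ∀ i, |x i| ≤ M) :
    ∃ s : Fin n → Bool, ∑ i, x i * g i ≤ M * ∑ i, (if s i then 1 else -1) * g i := by
  refine ⟨fun i => decide (0 ≤ g i), ?_⟩
  rw [Finset.mul_sum]
  refine Finset.sum_le_sum fun i _ => ?_
  have := abs_le.1 (hx i)
  by_cases h : 0 ≤ g i
  · simp only [h, decide_true, if_true]; nlinarith
  · simp only [h, decide_false]; push Not at h; norm_num; nlinarith

/-- The form is linear in x and in y separately, so over the cube of side 2M it is maximal at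
vertices; each of the two replacements by signs costs a factor M. -/
theorem SignBound.le_of_abs_le (h : SignBound W T) {M : ℝ} (hM : 0 ≤ M) (x y : Fin n → ℝ)
    (hx : ∀ i, |x i| ≤ M) (hy : ∀ i, |y i| ≤ M) :
    ∑ i, ∑ j, W i j * (x i * y j) ≤ M ^ 2 * T := by
  obtain ⟨s, hs⟩ := exists_sign_mul_le (fun i => ∑ j, W i j * y j) x hx
  obtain ⟨t, ht⟩ := exists_sign_mul_le (fun j => ∑ i, (if s i then 1 else -1) * W i j) y hy
  have e1 : ∑ i, ∑ j, W i j * (x i * y j) = ∑ i, x i * ∑ j, W i j * y j := by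
    simp only [Finset.mul_sum]
    exact Finset.sum_congr rfl fun i _ => Finset.sum_congr rfl fun j _ => by ring
  have e2 : ∑ i, (if s i then 1 else -1) * ∑ j, W i j * y j
      = ∑ j, y j * ∑ i, (if s i then 1 else -1) * W i j := by
    simp only [Finset.mul_sum]
    rw [Finset.sum_comm]
    exact Finset.sum_congr rfl fun i _ => Finset.sum_congr rfl fun j _ => by ring
  have e3 : ∑ j, (if t j then 1 else -1) * ∑ i, (if s i then 1 else -1) * W i j
      = ∑ i, ∑ j, (if s i then 1 else -1) * (if t j then 1 else -1) * W i j := by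
    simp only [Finset.mul_sum]
    rw [Finset.sum_comm]
    exact Finset.sum_congr rfl fun i _ => Finset.sum_congr rfl fun j _ => by ring
  rw [e1]
  rw [e2] at hs
  rw [e3] at ht
  have := h s t
  calc _ ≤ _ := hs
    _ ≤ M * (M * T) := by gcongr; exact ht.trans (by gcongr)
    _ = _ := by ring

theorem GramBound.of_fintype (h : GramBound W S) {ι : Type} [Fintype ι] (u v : Fin n → ι → ℝ)
    {a b : ℝ} (ha : 0 < a) (hb : 0 < b) (hu : ∀ i, ∑ k, u i k ^ 2 ≤ a ^ 2)
    (hv : ∀ i, ∑ k, v i k ^ 2 ≤ b ^ 2) :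
    ∑ i, ∑ j, W i j * ∑ k, u i k * v j k ≤ a * b * S := by
  let e := Fintype.equivFin ι
  have key := h (Fintype.card ι) (fun i k => u i (e.symm k) / a) (fun i k => v i (e.symm k) / b)
    (fun i => by
      rw [e.symm.sum_comp (fun k => (u i k / a) ^ 2)]
      simp only [div_pow, ← Finset.sum_div]
      exact div_le_one_of_le₀ (hu i) (sq_nonneg _))
    (fun i => by
      rw [e.symm.sum_comp (fun k => (v i k / b) ^ 2)]
      simp only [div_pow, ← Finset.sum_div]
      exact div_le_one_of_le₀ (hv i) (sq_nonneg _))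
  have e1 : ∑ i, ∑ j, W i j * ∑ k, u i (e.symm k) / a * (v j (e.symm k) / b)
      = (∑ i, ∑ j, W i j * ∑ k, u i k * v j k) / (a * b) := by
    rw [Finset.sum_div]
    refine Finset.sum_congr rfl fun i _ => ?_
    rw [Finset.sum_div]
    refine Finset.sum_congr rfl fun j _ => ?_
    rw [e.symm.sum_comp (fun k => u i k / a * (v j k / b)), mul_div_assoc, Finset.sum_div]
    congr 1
    exact Finset.sum_congr rfl fun k _ => by field_simp
  rw [e1, div_le_iff₀ (by positivity)] at key
  linarith

/-- Crude, but it shows that some finite bound exists, so the infimum of all bounds can be taken in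
`SignBound.gramBound`. -/
theorem gramBound_sum_abs (W : Matrix (Fin n) (Fin n) ℝ) : GramBound W (∑ i, ∑ j, |W i j|) := by
  intro m u v hu hv
  refine Finset.sum_le_sum fun i _ => Finset.sum_le_sum fun j _ => ?_
  have h1 : (∑ k, u i k * v j k) ^ 2 ≤ 1 :=
    (Finset.sum_mul_sq_le_sq_mul_sq _ _ _).trans
      (mul_le_one₀ (hu i) (Finset.sum_nonneg fun _ _ => sq_nonneg _) (hv j))
  have h2 : |∑ k, u i k * v j k| ≤ 1 := by rwa [← sq_le_one_iff_abs_le_one]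
  calc _ ≤ |W i j * ∑ k, u i k * v j k| := le_abs_self _
    _ = |W i j| * |∑ k, u i k * v j k| := abs_mul _ _
    _ ≤ _ := mul_le_of_le_one_right (abs_nonneg _) h2

/-- One truncation step in the proof of Grothendieck's inequality. -/
theorem GramBound.truncate (h : GramBound W S) (hT : SignBound W T) :
    GramBound W (48 * T + S / 2) := by
  intro m u v hu hv
  obtain ⟨Ω, _, e, w, hw, hc, he⟩ := exists_rademacher m
  -- The tail beyond M has second moment at most 3 / 48 = (1/4)², by the fourth moment bound. Two
  -- error terms of size S/4 then sum to S/2, and the truncated part costs M² T = 48 T.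
  let M : ℝ := √48
  have hM2 : M ^ 2 = 48 := Real.sq_sqrt (by norm_num)
  have hM0 : 0 ≤ M := Real.sqrt_nonneg _
  let X (u : Fin m → ℝ) (x : Ω) : ℝ := ∑ k, u k * e k x
  have hadd (u v : Fin m → ℝ) (x : Ω) : X (u + v) x = X u x + X v x := by
    simp only [X, Pi.add_apply, add_mul, Finset.sum_add_distrib]
  -- Polarization of the second moment identity.
  have hinner (u v : Fin m → ℝ) : ∑ k, u k * v k = w * ∑ x, X u x * X v x := by
    have h1 := (he (u + v)).1
    have h2 := (he u).1
    have h3 := (he v).1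
    change w * ∑ x, X (u + v) x ^ 2 = _ at h1
    change w * ∑ x, X u x ^ 2 = _ at h2
    change w * ∑ x, X v x ^ 2 = _ at h3
    simp only [hadd, Pi.add_apply, add_sq, Finset.sum_add_distrib, mul_assoc,
      ← Finset.mul_sum] at h1
    linarith
  let p (y : ℝ) : ℝ := if |y| ≤ M then y else 0
  let q (y : ℝ) : ℝ := if |y| ≤ M then 0 else y
  have hpq (y : ℝ) : y = p y + q y := by simp only [p, q]; split_ifs <;> simp
  have hpM (y : ℝ) : |p y| ≤ M := by
    simp only [p]; split_ifs with hy
    · exact hy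
    · rwa [abs_zero]
  have hp2 (y : ℝ) : p y ^ 2 ≤ y ^ 2 := by
    simp only [p]; split_ifs
    · exact le_rfl
    · simpa using sq_nonneg y
  have hq2 (y : ℝ) : q y ^ 2 ≤ y ^ 4 / 48 := by
    simp only [q]; split_ifs with hy
    · simp only [ne_eq, OfNat.ofNat_ne_zero, not_false_eq_true, zero_pow]; positivity
    · have : 48 ≤ y ^ 2 := by
        rw [← hM2, ← sq_abs y]; push Not at hy; gcongr
      rw [le_div_iff₀ (by norm_num)]; nlinarith [sq_nonneg y]
  have hs : √w * √w = w := Real.mul_self_sqrt hw.le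
  have hs2 : √w ^ 2 = w := Real.sq_sqrt hw.le
  have hfull (u : Fin m → ℝ) (hu : ∑ k, u k ^ 2 ≤ 1) : ∑ x, (√w * X u x) ^ 2 ≤ (1 : ℝ) ^ 2 := by
    simp only [mul_pow, ← Finset.mul_sum, hs2, one_pow]
    exact (he u).1.le.trans hu
  have hlow (u : Fin m → ℝ) (hu : ∑ k, u k ^ 2 ≤ 1) :
      ∑ x, (√w * p (X u x)) ^ 2 ≤ (1 : ℝ) ^ 2 := by
    refine le_trans (Finset.sum_le_sum fun x _ => ?_) (hfull u hu)
    rw [mul_pow, mul_pow]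
    exact mul_le_mul_of_nonneg_left (hp2 _) (sq_nonneg _)
  have htail (u : Fin m → ℝ) (hu : ∑ k, u k ^ 2 ≤ 1) :
      ∑ x, (√w * q (X u x)) ^ 2 ≤ (1 / 4 : ℝ) ^ 2 := by
    have h0 : 0 ≤ ∑ k, u k ^ 2 := Finset.sum_nonneg fun _ _ => sq_nonneg _
    have h4 : w * ∑ x, X u x ^ 4 ≤ 3 * (∑ k, u k ^ 2) ^ 2 := (he u).2
    simp only [mul_pow, ← Finset.mul_sum, hs2]
    calc w * ∑ x, q (X u x) ^ 2 ≤ w * ∑ x, X u x ^ 4 / 48 := by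
          gcongr with x; exact hq2 _
      _ = (w * ∑ x, X u x ^ 4) / 48 := by rw [← Finset.sum_div]; ring
      _ ≤ _ := by nlinarith
  have hA := h.of_fintype (fun i x => √w * q (X (u i) x)) (fun j x => √w * X (v j) x)
    (by norm_num : (0 : ℝ) < 1 / 4) one_pos (fun i => htail _ (hu i)) (fun j => hfull _ (hv j))
  have hB := h.of_fintype (fun i x => √w * p (X (u i) x)) (fun j x => √w * q (X (v j) x))
    one_pos (by norm_num : (0 : ℝ) < 1 / 4) (fun i => hlow _ (hu i)) (fun j => htail _ (hv j))
  have hC : ∑ i, ∑ j, W i j * ∑ x, (√w * p (X (u i) x)) * (√w * p (X (v j) x)) ≤ 48 * T := by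
    have e1 : ∑ i, ∑ j, W i j * ∑ x, (√w * p (X (u i) x)) * (√w * p (X (v j) x))
        = w * ∑ x, ∑ i, ∑ j, W i j * (p (X (u i) x) * p (X (v j) x)) := by
      simp only [Finset.mul_sum]
      symm
      rw [Finset.sum_comm]
      refine Finset.sum_congr rfl fun i _ => ?_
      rw [Finset.sum_comm]
      refine Finset.sum_congr rfl fun j _ => Finset.sum_congr rfl fun x _ => ?_
      linear_combination (-W i j * p (X (u i) x) * p (X (v j) x)) * hs
    rw [e1]
    calc _ ≤ w * ∑ x : Ω, M ^ 2 * T := by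
          gcongr with x
          exact hT.le_of_abs_le hM0 _ _ (fun i => hpM _) (fun j => hpM _)
      _ = (w * Fintype.card Ω) * (M ^ 2 * T) := by
          rw [Finset.sum_const, Finset.card_univ, nsmul_eq_mul]; ring
      _ = _ := by rw [hc, hM2, one_mul]
  -- With X = p + q, the product is expanded as X X' = p p' + q X' + p q'. Keeping X' whole leaves
  -- only two tail terms.
  have hsplit : ∑ i, ∑ j, W i j * ∑ k, u i k * v j k
      = ∑ i, ∑ j, W i j * ∑ x, (√w * p (X (u i) x)) * (√w * p (X (v j) x))
      + ∑ i, ∑ j, W i j * ∑ x, (√w * q (X (u i) x)) * (√w * X (v j) x)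
      + ∑ i, ∑ j, W i j * ∑ x, (√w * p (X (u i) x)) * (√w * q (X (v j) x)) := by
    simp only [← Finset.sum_add_distrib, ← mul_add]
    refine Finset.sum_congr rfl fun i _ => Finset.sum_congr rfl fun j _ => ?_
    rw [hinner, Finset.mul_sum]
    congr 1
    refine Finset.sum_congr rfl fun x _ => ?_
    have h1 := hpq (X (u i) x)
    have h2 := hpq (X (v j) x)
    linear_combination (-X (u i) x * X (v j) x) * hs + w * X (v j) x * h1 + w * p (X (u i) x) * h2
      + (X (u i) x * X (v j) x - p (X (u i) x) * p (X (v j) x) - q (X (u i) x) * X (v j) x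
        - p (X (u i) x) * q (X (v j) x)) * hs
  rw [hsplit]
  linarith

/-- **Grothendieck's inequality** with constant `96`. -/
theorem SignBound.gramBound (hT : SignBound W T) : GramBound W (96 * T) := by
  set A : Set ℝ := {S | GramBound W S} with hA
  have hne : A.Nonempty := ⟨_, gramBound_sum_abs W⟩
  have hbdd : BddBelow A := by
    refine ⟨0, fun S hS => ?_⟩
    simpa using hS 0 0 0 (by simp) (by simp)
  have hmem : GramBound W (sInf A) := fun m u v hu hv =>
    le_csInf hne fun S hS => hS m u v hu hv
  -- The infimum is itself a bound, so truncating cannot improve on it; solving the inequality gives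
  -- 96 T.
  have hle : sInf A ≤ 48 * T + sInf A / 2 := csInf_le hbdd (hmem.truncate hT)
  exact fun m u v hu hv => (hmem m u v hu hv).trans (by linarith)

/-- A positive semidefinite Y with unit diagonal is the Gram matrix of unit vectors, the columns of
C in Y = Cᵀ C. Negating one family of vectors gives the lower bound. -/
theorem SignBound.abs_sum_mul_posSemidef_le (hT : SignBound W T) {Y : Matrix (Fin n) (Fin n) ℝ}
    (hY : Y.PosSemidef) (hd : ∀ i, Y i i = 1) : |∑ i, ∑ j, Y i j * W i j| ≤ 96 * T := by
  obtain ⟨C, hC⟩ : ∃ C : Matrix (Fin n) (Fin n) ℝ, Y = C.conjTranspose * C := by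
    open scoped MatrixOrder in
    exact CStarAlgebra.nonneg_iff_eq_star_mul_self.mp hY.nonneg
  have hent (i j) : Y i j = ∑ k, C k i * C k j := by
    rw [hC]; simp [Matrix.mul_apply]
  have hu (i) : ∑ k, C k i ^ 2 ≤ 1 := by
    rw [← hd i, hent]; simp only [sq, le_refl]
  have h1 := hT.gramBound n (fun i k => C k i) (fun i k => C k i) hu hu
  have h2 := hT.gramBound n (fun i k => -C k i) (fun i k => C k i) (by simpa using hu) hu
  simp only [neg_mul, Finset.sum_neg_distrib, mul_neg, ← hent] at h1 h2
  rw [abs_le]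
  simp only [mul_comm (Y _ _)]
  exact ⟨by linarith, h1⟩

end Grothendieck

/-! ### Exponential moments and tails for independent indicators. -/

section Chernoff

variable {Ω : Type*} [MeasurableSpace Ω] {μ : Measure Ω} [IsProbabilityMeasure μ]

/-- The bounds on a and η ensure |ηa| ≤ 1, where exp x - 1 - x ≤ x². Combined with 1 + y ≤ exp y
this leaves the exponent p (ηa)² ≤ 4 η² p, proportional to p rather than a constant; sparse graphs
need this. -/
theorem mgf_centered_indicator_le {E : Set Ω} (hE : MeasurableSet E) {a η : ℝ} (ha : |a| ≤ 2)
    (h0 : 0 ≤ η) (h1 : η ≤ 1 / 2) :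
    mgf (fun ω => a * (E.indicator (fun _ => (1 : ℝ)) ω - μ.real E)) μ η
      ≤ Real.exp (4 * η ^ 2 * μ.real E) := by
  set p := μ.real E with hp
  have hp0 : 0 ≤ p := measureReal_nonneg
  have e1 : ∀ ω, Real.exp (η * (a * (E.indicator (fun _ => (1 : ℝ)) ω - p)))
      = Real.exp (-(η * a * p))
        * (1 + E.indicator (fun _ => Real.exp (η * a) - 1) ω) := by
    intro ω
    by_cases h : ω ∈ E
    · simp only [Set.indicator_of_mem h]
      rw [add_sub_cancel, ← Real.exp_add]; congr 1; ring
    · simp only [Set.indicator_of_notMem h]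
      rw [add_zero, mul_one]; congr 1; ring
  have hx : |η * a| ≤ 1 := by
    rw [abs_mul, abs_of_nonneg h0]; nlinarith [abs_nonneg a]
  have h2 := abs_le.1 (Real.abs_exp_sub_one_sub_id_le hx)
  have ha2 : a ^ 2 ≤ 4 := by
    have := abs_le.1 ha
    nlinarith
  simp only [mgf, e1]
  rw [integral_const_mul, integral_add (integrable_const _)
    ((integrable_const _).indicator hE), integral_indicator_const _ hE, integral_const]
  simp only [probReal_univ, smul_eq_mul, one_mul, ← hp]
  calc _ ≤ Real.exp (-(η * a * p)) * Real.exp (p * (Real.exp (η * a) - 1)) := by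
        gcongr
        linarith [Real.add_one_le_exp (p * (Real.exp (η * a) - 1))]
    _ = Real.exp (p * (Real.exp (η * a) - 1 - η * a)) := by
        rw [← Real.exp_add]; congr 1; ring
    _ ≤ _ := by
        refine Real.exp_le_exp.2 ?_
        have : (η * a) ^ 2 ≤ 4 * η ^ 2 := by nlinarith [sq_nonneg η]
        nlinarith

/-- Chernoff bound for a weighted sum of centered independent indicators. -/
theorem measureReal_sum_centered_indicator_ge_le {ι : Type*} [Fintype ι] {E : ι → Set Ω}
    (hE : ∀ e, MeasurableSet (E e)) (hind : iIndepSet E μ) {a : ι → ℝ} (ha : ∀ e, |a e| ≤ 2)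
    {η : ℝ} (h0 : 0 ≤ η) (h1 : η ≤ 1 / 2) (t : ℝ) :
    μ.real {ω | t ≤ ∑ e, a e * ((E e).indicator (fun _ => (1 : ℝ)) ω - μ.real (E e))}
      ≤ Real.exp (-η * t + 4 * η ^ 2 * ∑ e, μ.real (E e)) := by
  set X : ι → Ω → ℝ := fun e ω => a e * ((E e).indicator (fun _ => (1 : ℝ)) ω - μ.real (E e))
    with hX
  have hXm : ∀ e, Measurable (X e) := fun e =>
    ((measurable_const.indicator (hE e)).sub_const _).const_mul _
  have hXi : iIndepFun X μ :=
    (hind.iIndepFun_indicator (β := ℝ)).comp (fun e x => a e * (x - μ.real (E e)))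
      (fun e => (measurable_id.sub_const _).const_mul _)
  have hS : (fun ω => ∑ e, a e * ((E e).indicator (fun _ => (1 : ℝ)) ω - μ.real (E e)))
      = ∑ e, X e := by
    ext ω; simp [hX]
  have hSm : Measurable (∑ e, X e) := by
    rw [← hS]; exact Finset.measurable_sum _ fun e _ => hXm e
  have hbd : ∀ ω, |(∑ e, X e) ω| ≤ ∑ _e : ι, 2 := by
    intro ω
    rw [Finset.sum_apply]
    refine (Finset.abs_sum_le_sum_abs _ _).trans (Finset.sum_le_sum fun e _ => ?_)
    have hp0 : 0 ≤ μ.real (E e) := measureReal_nonneg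
    have hp1 : μ.real (E e) ≤ 1 := measureReal_le_one
    have : |(E e).indicator (fun _ => (1 : ℝ)) ω - μ.real (E e)| ≤ 1 := by
      rw [abs_le]
      by_cases h : ω ∈ E e
      · simp only [Set.indicator_of_mem h]; constructor <;> linarith
      · simp only [Set.indicator_of_notMem h]; constructor <;> linarith
    simp only [hX, abs_mul]
    nlinarith [ha e, abs_nonneg (a e)]
  have hint : Integrable (fun ω => Real.exp (η * (∑ e, X e) ω)) μ :=
    integrable_exp_mul_of_mem_Icc hSm.aemeasurable
      (Filter.Eventually.of_forall fun ω => ⟨(abs_le.1 (hbd ω)).1, (abs_le.1 (hbd ω)).2⟩)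
  have key := measure_ge_le_exp_mul_mgf t h0 hint
  rw [hXi.mgf_sum hXm] at key
  have hset : {ω | t ≤ ∑ e, a e * ((E e).indicator (fun _ => (1 : ℝ)) ω - μ.real (E e))}
      = {ω | t ≤ (∑ e, X e) ω} := by rw [← hS]
  rw [hset]
  refine key.trans ?_
  rw [Real.exp_add, Finset.mul_sum, Real.exp_sum]
  gcongr with e
  · exact fun _ _ => mgf_nonneg
  · exact mgf_centered_indicator_le (hE e) (ha e) h0 h1

end Chernoff

/-- Independence is available only over unordered pairs, so full double sums are folded onto i < j.
-/
theorem sum_offDiag_eq_sum_lt {n : ℕ} (f : Fin n → Fin n → ℝ) (hf : ∀ i, f i i = 0) :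
    ∑ i, ∑ j, f i j
      = ∑ e : {e : Fin n × Fin n // e.1 < e.2}, (f e.1.1 e.1.2 + f e.1.2 e.1.1) := by
  have h1 : ∑ e : {e : Fin n × Fin n // e.1 < e.2}, (f e.1.1 e.1.2 + f e.1.2 e.1.1)
      = ∑ e : Fin n × Fin n, if e.1 < e.2 then f e.1 e.2 + f e.2 e.1 else 0 := by
    rw [← Finset.sum_filter]
    exact (Finset.sum_subtype (p := fun e : Fin n × Fin n => e.1 < e.2)
      (Finset.univ.filter fun e : Fin n × Fin n => e.1 < e.2) (by simp)
      (fun e => f e.1 e.2 + f e.2 e.1)).symm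
  have h2 : ∑ i, ∑ j, f i j
      = ∑ i, ∑ j, (if i < j then f i j else 0) + ∑ i, ∑ j, (if j < i then f i j else 0) := by
    simp only [← Finset.sum_add_distrib]
    refine Finset.sum_congr rfl fun i _ => Finset.sum_congr rfl fun j _ => ?_
    rcases lt_trichotomy i j with h | h | h
    · simp [h, h.not_gt]
    · subst h; simp [hf]
    · simp [h, h.not_gt]
  rw [h1, Fintype.sum_prod_type, h2, Finset.sum_comm (f := fun i j => if j < i then f i j else 0)]
  simp only [← Finset.sum_add_distrib]
  refine Finset.sum_congr rfl fun i _ => Finset.sum_congr rfl fun j _ => ?_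
  split_ifs <;> simp

/-! ### Concentration of the noise and of the total degree in the block model. -/

section Model

variable {n r : ℕ} {θ : Fin n → ℝ} {c : Fin n → Fin r} {B : Matrix (Fin r) (Fin r) ℝ}

/-- The matrix `θ_i θ_j B_{ab}` with `i ∈ C_a`, `j ∈ C_b`. -/
def edgeProb (θ : Fin n → ℝ) (c : Fin n → Fin r) (B : Matrix (Fin r) (Fin r) ℝ) :
    Matrix (Fin n) (Fin n) ℝ :=
  Matrix.of fun i j => θ i * θ j * B (c i) (c j)

/-- The deviation of `A` from the off-diagonal part of `P`. -/
def noise (A P : Matrix (Fin n) (Fin n) ℝ) : Matrix (Fin n) (Fin n) ℝ :=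
  Matrix.of fun i j => A i j - if i = j then 0 else P i j

theorem edgeProb_nonneg (h : IsParam θ c B) (i j : Fin n) : 0 ≤ edgeProb θ c B i j :=
  mul_nonneg (mul_nonneg (h.theta_nonneg i) (h.theta_nonneg j)) (h.B_nonneg _ _)

theorem edgeProb_comm (h : IsParam θ c B) (i j : Fin n) :
    edgeProb θ c B i j = edgeProb θ c B j i := by
  simp only [edgeProb, Matrix.of_apply]
  rw [← h.B_symm.apply (c i) (c j)]; ring

theorem sum_edgeProb (i : Fin n) : ∑ j, edgeProb θ c B i j = nodeDegree θ c B i := by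
  simp only [edgeProb, nodeDegree, clusterDegree, clusterWeight, Matrix.of_apply, Finset.mul_sum]
  rw [← Finset.sum_fiberwise (Finset.univ) c]
  refine Finset.sum_congr rfl fun b _ => Finset.sum_congr rfl fun j hj => ?_
  rw [(Finset.mem_filter.1 hj).2]; ring

theorem nodeDegree_nonneg (h : IsParam θ c B) (i : Fin n) : 0 ≤ nodeDegree θ c B i := by
  rw [← sum_edgeProb]; exact Finset.sum_nonneg fun j _ => edgeProb_nonneg h i j

theorem l1Norm_nodeDegree (h : IsParam θ c B) :
    l1Norm (nodeDegree θ c B) = ∑ i, ∑ j, edgeProb θ c B i j := by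
  simp only [l1Norm, abs_of_nonneg (nodeDegree_nonneg h _), sum_edgeProb]

theorem l1Norm_nonneg (v : Fin n → ℝ) : 0 ≤ l1Norm v :=
  Finset.sum_nonneg fun _ _ => abs_nonneg _

theorem two_mul_sum_edgeProb_le (h : IsParam θ c B) :
    2 * ∑ e : {e : Fin n × Fin n // e.1 < e.2}, edgeProb θ c B e.1.1 e.1.2
      ≤ l1Norm (nodeDegree θ c B) := by
  have := sum_offDiag_eq_sum_lt (fun i j => if i = j then 0 else edgeProb θ c B i j) (by simp)
  have h2 : ∑ i, ∑ j, (if i = j then 0 else edgeProb θ c B i j) ≤ l1Norm (nodeDegree θ c B) := by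
    rw [l1Norm_nodeDegree h]
    refine Finset.sum_le_sum fun i _ => Finset.sum_le_sum fun j _ => ?_
    split_ifs
    · exact edgeProb_nonneg h i j
    · exact le_rfl
  refine le_trans (le_of_eq ?_) h2
  rw [this, Finset.mul_sum]
  refine Finset.sum_congr rfl fun e _ => ?_
  simp only [e.2.ne, e.2.ne', if_false]
  rw [edgeProb_comm h e.1.2]; ring

theorem adjacency_nonneg (G : SimpleGraph (Fin n)) (i j : Fin n) : 0 ≤ adjacency G i j := by
  classical
  simp only [adjacency, SimpleGraph.adjMatrix_apply]; split_ifs <;> norm_num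

theorem adjacency_self (G : SimpleGraph (Fin n)) (i : Fin n) : adjacency G i i = 0 := by
  simp [adjacency]

theorem adjacency_eq_indicator {Ω : Type*} (G : Ω → SimpleGraph (Fin n)) (i j : Fin n) (ω : Ω) :
    adjacency (G ω) i j = {ω | (G ω).Adj i j}.indicator (fun _ => (1 : ℝ)) ω := by
  classical
  simp [adjacency, SimpleGraph.adjMatrix_apply, Set.indicator_apply]

variable {Ω : Type*} [MeasurableSpace Ω] {μ : Measure Ω} {G : Ω → SimpleGraph (Fin n)}

/-- After folding, each edge carries the coefficient a_i b_j + a_j b_i, at most 2 in absolute value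
for signs; this is the range allowed in the Chernoff bound. -/
theorem sum_sign_mul_noise (h : IsParam θ c B) (hG : IsRandomGraph θ c B μ G) (a b : Fin n → ℝ)
    (ω : Ω) :
    ∑ i, ∑ j, a i * b j * noise (adjacency (G ω)) (edgeProb θ c B) i j
      = ∑ e : {e : Fin n × Fin n // e.1 < e.2}, (a e.1.1 * b e.1.2 + a e.1.2 * b e.1.1) *
        ({ω | (G ω).Adj e.1.1 e.1.2}.indicator (fun _ => (1 : ℝ)) ω
          - μ.real {ω | (G ω).Adj e.1.1 e.1.2}) := by
  rw [sum_offDiag_eq_sum_lt _ (by simp [noise, adjacency_self])]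
  refine Finset.sum_congr rfl fun e _ => ?_
  rw [hG.prob_adj _ _ e.2.ne, ← adjacency_eq_indicator]
  have h1 : adjacency (G ω) e.1.2 e.1.1 = adjacency (G ω) e.1.1 e.1.2 := by
    simp only [adjacency_eq_indicator, SimpleGraph.adj_comm]
  have h2 := edgeProb_comm h e.1.2 e.1.1
  simp only [noise, Matrix.of_apply, e.2.ne, e.2.ne', if_false, h1, h2]
  simp only [edgeProb, Matrix.of_apply]
  ring

/-- The radius of the concentration event. -/
noncomputable def radius (n : ℕ) (F : ℝ) : ℝ := 4 * (√(n * F) + n)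

theorem exists_chernoff_parameter (n : ℕ) {F : ℝ} (hF : 0 ≤ F) :
    ∃ η : ℝ, 0 ≤ η ∧ η ≤ 1 / 2 ∧ -η * radius n F + 2 * η ^ 2 * F ≤ -(2 * n) := by
  have hn : (0 : ℝ) ≤ n := Nat.cast_nonneg n
  have hs0 := Real.sqrt_nonneg ((n : ℝ) * F)
  have hs := Real.sq_sqrt (mul_nonneg hn hF)
  simp only [radius]
  set s := √((n : ℝ) * F)
  -- The unconstrained choice is η = √(n/F), which equals s / F. It is admissible once F > 4n;
  -- otherwise η is capped at 1/2, and F ≤ 2s absorbs the quadratic term.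
  by_cases h : F ≤ 4 * n
  · refine ⟨1 / 2, by norm_num, le_rfl, ?_⟩
    have : F ≤ 2 * s := by
      refine abs_le_of_sq_le_sq' ?_ (by positivity) |>.2
      nlinarith
    nlinarith
  · push Not at h
    have hF' : 0 < F := by linarith
    refine ⟨s / F, by positivity, ?_, ?_⟩
    · rw [div_le_iff₀ hF']
      refine abs_le_of_sq_le_sq' ?_ (by positivity) |>.2
      nlinarith
    · have e1 : s / F * s = n := by field_simp; linarith
      have e2 : (s / F) ^ 2 * F = n := by field_simp; linarith
      have e3 : 0 ≤ s / F * n := by positivity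
      nlinarith

variable [IsProbabilityMeasure μ]

theorem measureReal_sign_ge_le (h : IsParam θ c B) (hG : IsRandomGraph θ c B μ G)
    (s t : Fin n → Bool) :
    μ.real {ω | radius n (l1Norm (nodeDegree θ c B)) ≤
      ∑ i, ∑ j, (if s i then 1 else -1) * (if t j then 1 else -1) *
        noise (adjacency (G ω)) (edgeProb θ c B) i j} ≤ Real.exp (-(2 * n)) := by
  obtain ⟨η, h0, h1, h2⟩ := exists_chernoff_parameter n (l1Norm_nonneg (nodeDegree θ c B))
  simp only [sum_sign_mul_noise h hG]
  refine (measureReal_sum_centered_indicator_ge_le (fun e => hG.measurableSet_adj _ _) hG.indep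
    (fun e => ?_) h0 h1 _).trans (Real.exp_le_exp.2 (le_trans ?_ h2))
  · split_ifs <;> norm_num
  · have e1 : ∑ e : {e : Fin n × Fin n // e.1 < e.2}, μ.real {ω | (G ω).Adj e.1.1 e.1.2}
        = ∑ e : {e : Fin n × Fin n // e.1 < e.2}, edgeProb θ c B e.1.1 e.1.2 :=
      Finset.sum_congr rfl fun e _ => hG.prob_adj _ _ e.2.ne
    rw [e1]
    nlinarith [two_mul_sum_edgeProb_le h, sq_nonneg η]

/-- Union bound: 4^n exp(-2n) = (e/2)^(-2n), so the factor 2 is slack. -/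
theorem measureReal_not_signBound_le (h : IsParam θ c B) (hG : IsRandomGraph θ c B μ G) :
    μ.real {ω | ¬ SignBound (noise (adjacency (G ω)) (edgeProb θ c B))
      (radius n (l1Norm (nodeDegree θ c B)))} ≤ 2 * (Real.exp 1 / 2) ^ (-(2 * (n : ℤ))) := by
  have hsub : {ω | ¬ SignBound (noise (adjacency (G ω)) (edgeProb θ c B))
      (radius n (l1Norm (nodeDegree θ c B)))} ⊆
      ⋃ st : (Fin n → Bool) × (Fin n → Bool), {ω | radius n (l1Norm (nodeDegree θ c B)) ≤
        ∑ i, ∑ j, (if st.1 i then 1 else -1) * (if st.2 j then 1 else -1) *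
          noise (adjacency (G ω)) (edgeProb θ c B) i j} := by
    intro ω hω
    simp only [SignBound, Set.mem_ofPred_eq, not_forall, not_le] at hω
    obtain ⟨s, t, hst⟩ := hω
    exact Set.mem_iUnion.2 ⟨(s, t), hst.le⟩
  refine (measureReal_mono hsub).trans ((measureReal_iUnion_fintype_le _).trans ?_)
  refine (Finset.sum_le_sum fun st _ => measureReal_sign_ge_le h hG st.1 st.2).trans ?_
  have e1 : (Real.exp 1 / 2) ^ (-(2 * (n : ℤ))) = (2 : ℝ) ^ n * 2 ^ n * Real.exp (-(2 * n)) := by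
    rw [Real.exp_neg, zpow_neg, show (2 * (n : ℤ)) = ((2 * n : ℕ) : ℤ) by push_cast; rfl,
      zpow_natCast, div_pow, ← Real.exp_nat_mul, ← pow_add, ← two_mul]
    push_cast
    rw [mul_one, inv_div, div_eq_mul_inv]
  rw [Finset.sum_const, Finset.card_univ, nsmul_eq_mul, e1]
  simp only [Fintype.card_prod, Fintype.card_fun, Fintype.card_bool, Fintype.card_fin]
  push_cast
  have : (0 : ℝ) ≤ 2 ^ n * 2 ^ n * Real.exp (-(2 * n)) := by positivity
  linarith

/-- Markov's inequality. The expected total degree is at most ‖f‖₁, since f also counts the diagonal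
probabilities. -/
theorem measureReal_degree_ge_le (h : IsParam θ c B) (hG : IsRandomGraph θ c B μ G)
    (hF : 0 < l1Norm (nodeDegree θ c B)) :
    μ.real {ω | 100 * l1Norm (nodeDegree θ c B) ≤ l1Norm (degreeVec (adjacency (G ω)))}
      ≤ 0.01 := by
  have hmeas (i j) : MeasurableSet {ω | (G ω).Adj i j} := hG.measurableSet_adj i j
  have hd : ∀ ω, l1Norm (degreeVec (adjacency (G ω)))
      = ∑ i, ∑ j, {ω | (G ω).Adj i j}.indicator (fun _ => (1 : ℝ)) ω := by
    intro ω
    simp only [← adjacency_eq_indicator, l1Norm, degreeVec]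
    exact Finset.sum_congr rfl fun i _ =>
      abs_of_nonneg (Finset.sum_nonneg fun j _ => adjacency_nonneg _ i j)
  have hI (i j) : Integrable ({ω | (G ω).Adj i j}.indicator (fun _ => (1 : ℝ))) μ :=
    (integrable_const _).indicator (hmeas i j)
  have hint : Integrable (fun ω => l1Norm (degreeVec (adjacency (G ω)))) μ := by
    simp only [hd]
    exact integrable_finsetSum _ fun i _ => integrable_finsetSum _ fun j _ => hI i j
  have hE : ∫ ω, l1Norm (degreeVec (adjacency (G ω))) ∂μ ≤ l1Norm (nodeDegree θ c B) := by
    simp only [hd]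
    rw [integral_finsetSum _ fun i _ => integrable_finsetSum _ fun j _ => hI i j,
      l1Norm_nodeDegree h]
    refine Finset.sum_le_sum fun i _ => ?_
    rw [integral_finsetSum _ fun j _ => hI i j]
    refine Finset.sum_le_sum fun j _ => ?_
    rw [integral_indicator_const _ (hmeas i j), smul_eq_mul, mul_one]
    by_cases hij : i = j
    · subst hij
      simpa using edgeProb_nonneg h i i
    · exact (hG.prob_adj i j hij).le
  have := mul_meas_ge_le_integral_of_nonneg
    (Filter.Eventually.of_forall fun ω => l1Norm_nonneg _) hint (100 * l1Norm (nodeDegree θ c B))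
  rw [mul_assoc] at this
  have h3 : l1Norm (nodeDegree θ c B) * (100 * μ.real {ω | 100 * l1Norm (nodeDegree θ c B)
      ≤ l1Norm (degreeVec (adjacency (G ω)))}) ≤ l1Norm (nodeDegree θ c B) * 1 := by linarith
  have := le_of_mul_le_mul_left h3 hF
  norm_num; linarith

end Model

/-! ### Deterministic error bound for an optimal solution. -/

section Deterministic

variable {n r : ℕ} {θ : Fin n → ℝ} {c : Fin n → Fin r} {B : Matrix (Fin r) (Fin r) ℝ}

theorem partitionMatrix_mem_feasibleSet (c : Fin n → Fin r) :
    partitionMatrix c ∈ feasibleSet n := by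
  refine ⟨?_, fun i j => ?_, fun i => by simp [partitionMatrix]⟩
  · have : partitionMatrix c
        = (Matrix.of fun (a : Fin r) i => if c i = a then (1 : ℝ) else 0).conjTranspose
          * (Matrix.of fun (a : Fin r) i => if c i = a then (1 : ℝ) else 0) := by
      ext i j
      simp [partitionMatrix, Matrix.mul_apply, eq_comm]
    rw [this]
    exact Matrix.posSemidef_conjTranspose_mul_self _
  · simp only [partitionMatrix, Matrix.of_apply]; split_ifs <;> norm_num

/-- Take s to be the signs of the row sums and t constantly +1. -/
theorem SignBound.sum_abs_sum_le {W : Matrix (Fin n) (Fin n) ℝ} {T : ℝ} (hT : SignBound W T) :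
    ∑ i, |∑ j, W i j| ≤ T := by
  refine le_trans (le_of_eq ?_) (hT (fun i => decide (0 ≤ ∑ j, W i j)) fun _ => true)
  refine Finset.sum_congr rfl fun i _ => ?_
  simp only [if_true, mul_one, ← Finset.mul_sum]
  by_cases h : 0 ≤ ∑ j, W i j
  · simp [h, abs_of_nonneg h]
  · simp [h, abs_of_neg (not_le.1 h)]

/-- Row sums of the noise differ from d - f by the diagonal entries of P, each in [0, 1]; they
account for the extra n. -/
theorem SignBound.l1Norm_degreeVec_sub_le (h : IsParam θ c B) {A : Matrix (Fin n) (Fin n) ℝ} {T : ℝ}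
    (hT : SignBound (noise A (edgeProb θ c B)) T) :
    l1Norm (degreeVec A - nodeDegree θ c B) ≤ T + n := by
  have h1 : ∀ i, |(degreeVec A - nodeDegree θ c B) i|
      ≤ |∑ j, noise A (edgeProb θ c B) i j| + 1 := by
    intro i
    have e1 : (degreeVec A - nodeDegree θ c B) i
        = ∑ j, noise A (edgeProb θ c B) i j - edgeProb θ c B i i := by
      have : ∑ j, (if i = j then 0 else edgeProb θ c B i j)
          = ∑ j, edgeProb θ c B i j - edgeProb θ c B i i := by
        have hite : ∀ j, (if i = j then 0 else edgeProb θ c B i j)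
            = edgeProb θ c B i j - if i = j then edgeProb θ c B i j else 0 := by
          intro j; split_ifs <;> simp
        simp only [hite, Finset.sum_sub_distrib, Finset.sum_ite_eq, Finset.mem_univ, if_true]
      simp only [noise, Matrix.of_apply, Finset.sum_sub_distrib, this, sum_edgeProb, degreeVec,
        Pi.sub_apply]
      ring
    have h0 := edgeProb_nonneg h i i
    have h1 : edgeProb θ c B i i ≤ 1 := h.prob_le_one i i
    rw [e1]
    refine (abs_sub _ _).trans ?_
    rw [abs_of_nonneg h0]
    linarith
  calc l1Norm (degreeVec A - nodeDegree θ c B)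
      ≤ ∑ i, (|∑ j, noise A (edgeProb θ c B) i j| + 1) := Finset.sum_le_sum fun i _ => h1 i
    _ ≤ _ := by
      rw [Finset.sum_add_distrib]
      simpa using hT.sum_abs_sum_le

theorem sum_abs_mul_sub_mul_le (d f : Fin n → ℝ) :
    ∑ i, ∑ j, |d i * d j - f i * f j| ≤ (l1Norm d + l1Norm f) * l1Norm (d - f) := by
  have e1 : (l1Norm d + l1Norm f) * l1Norm (d - f)
      = ∑ i, ∑ j, (|d i| * |d j - f j| + |d i - f i| * |f j|) := by
    simp only [Finset.sum_add_distrib, ← Finset.mul_sum, ← Finset.sum_mul, l1Norm, Pi.sub_apply]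
    ring
  rw [e1]
  refine Finset.sum_le_sum fun i _ => Finset.sum_le_sum fun j _ => ?_
  rw [← abs_mul, ← abs_mul]
  refine le_trans (le_of_eq ?_) (abs_add_le _ _)
  congr 1; ring

/-- Entrywise consequence of the density gap: `P - lam f fᵀ` separates the partition matrix from
every feasible matrix. -/
theorem mul_abs_le_of_gap (h : IsParam θ c B) {lam δ : ℝ}
    (hH : ∀ a, 0 < clusterDegree θ c B a)
    (hout : ∀ a b : Fin r, a < b →
      (B a b + δ) / (clusterDegree θ c B a * clusterDegree θ c B b) < lam)
    (hin : ∀ a : Fin r, lam < (B a a - δ) / clusterDegree θ c B a ^ 2)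
    {Y : Matrix (Fin n) (Fin n) ℝ} (hY : ∀ i j, 0 ≤ Y i j ∧ Y i j ≤ 1) (i j : Fin n) :
    δ * |θ i * (partitionMatrix c - Y) i j * θ j| ≤ (partitionMatrix c - Y) i j *
      (edgeProb θ c B i j - lam * (nodeDegree θ c B i * nodeDegree θ c B j)) := by
  have hθ : 0 ≤ θ i * θ j := mul_nonneg (h.theta_nonneg i) (h.theta_nonneg j)
  have hout' : ∀ a b : Fin r, a ≠ b →
      B a b + δ ≤ lam * (clusterDegree θ c B a * clusterDegree θ c B b) := by
    intro a b hab
    rcases lt_or_gt_of_ne hab with hlt | hlt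
    · exact ((div_lt_iff₀ (mul_pos (hH a) (hH b))).1 (hout a b hlt)).le
    · have := ((div_lt_iff₀ (mul_pos (hH b) (hH a))).1 (hout b a hlt)).le
      rw [h.B_symm.apply a b] at this
      linarith
  have e1 : edgeProb θ c B i j - lam * (nodeDegree θ c B i * nodeDegree θ c B j)
      = θ i * θ j * (B (c i) (c j) - lam * (clusterDegree θ c B (c i) *
        clusterDegree θ c B (c j))) := by
    simp only [edgeProb, nodeDegree, Matrix.of_apply]; ring
  have e2 : |θ i * (partitionMatrix c - Y) i j * θ j|
      = θ i * θ j * |(partitionMatrix c - Y) i j| := by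
    rw [mul_right_comm, abs_mul, abs_of_nonneg hθ]
  have hYij := hY i j
  rw [e1, e2]
  -- With θ_i θ_j factored out, the two factors on the right have equal signs: nonnegative within a
  -- cluster, nonpositive across clusters. The second one has absolute value at least δ.
  suffices δ * |(partitionMatrix c - Y) i j| ≤ (partitionMatrix c - Y) i j *
      (B (c i) (c j) - lam * (clusterDegree θ c B (c i) * clusterDegree θ c B (c j))) by
    nlinarith
  simp only [Matrix.sub_apply, partitionMatrix, Matrix.of_apply]
  by_cases hc : c i = c j
  · have := (lt_div_iff₀ (pow_pos (hH (c j)) 2)).1 (hin (c j))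
    rw [if_pos hc, hc, abs_of_nonneg (by linarith)]
    nlinarith
  · have := hout' _ _ hc
    rw [if_neg hc, zero_sub, abs_neg, abs_of_nonneg hYij.1]
    nlinarith

theorem IsSolution.weightedL1Norm_sub_le (h : IsParam θ c B) {lam δ T : ℝ} (hlam : 0 ≤ lam)
    (hH : ∀ a, 0 < clusterDegree θ c B a)
    (hout : ∀ a b : Fin r, a < b →
      (B a b + δ) / (clusterDegree θ c B a * clusterDegree θ c B b) < lam)
    (hin : ∀ a : Fin r, lam < (B a a - δ) / clusterDegree θ c B a ^ 2)
    {A Y : Matrix (Fin n) (Fin n) ℝ} (hY : IsSolution A lam Y)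
    (hT : SignBound (noise A (edgeProb θ c B)) T) :
    δ * weightedL1Norm θ (partitionMatrix c - Y) ≤ 192 * T +
      lam * ((l1Norm (degreeVec A) + l1Norm (nodeDegree θ c B)) * (T + n)) := by
  obtain ⟨⟨hpsd, h01, hdiag⟩, hmax⟩ := hY
  have hpart := partitionMatrix_mem_feasibleSet c
  have hopt := hmax hpart
  obtain ⟨hpsd', h01', hdiag'⟩ := hpart
  set Z := partitionMatrix c with hZ
  set P := edgeProb θ c B
  set d := degreeVec A
  set f := nodeDegree θ c B
  have hb := abs_le.1 (hT.abs_sum_mul_posSemidef_le hpsd hdiag)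
  have hb' := abs_le.1 (hT.abs_sum_mul_posSemidef_le hpsd' hdiag')
  have hgap : δ * weightedL1Norm θ (Z - Y)
      ≤ ∑ i, ∑ j, (Z - Y) i j * (P i j - lam * (f i * f j)) := by
    simp only [weightedL1Norm, Finset.mul_sum]
    exact Finset.sum_le_sum fun i _ => Finset.sum_le_sum fun j _ =>
      mul_abs_le_of_gap h hH hout hin h01 i j
  -- The noise omits the diagonal of P, which does no harm: Z and Y both have unit diagonal, so
  -- diagonal terms of Z - Y vanish.
  have hsplit : ∑ i, ∑ j, (Z - Y) i j * (P i j - lam * (f i * f j))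
      = objective A lam Z - objective A lam Y + ∑ i, ∑ j, Y i j * noise A P i j
        - ∑ i, ∑ j, Z i j * noise A P i j
        + lam * ∑ i, ∑ j, (Z - Y) i j * (d i * d j - f i * f j) := by
    simp only [objective, Finset.mul_sum, ← Finset.sum_add_distrib, ← Finset.sum_sub_distrib]
    refine Finset.sum_congr rfl fun i _ => Finset.sum_congr rfl fun j _ => ?_
    simp only [Matrix.sub_apply, noise, Matrix.of_apply]
    split_ifs with hij
    · subst hij; rw [hdiag, hdiag']; ring
    · ring
  have hdd : ∑ i, ∑ j, (Z - Y) i j * (d i * d j - f i * f j)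
      ≤ (l1Norm d + l1Norm f) * (T + n) := by
    calc _ ≤ ∑ i, ∑ j, |d i * d j - f i * f j| := by
          refine Finset.sum_le_sum fun i _ => Finset.sum_le_sum fun j _ => ?_
          refine (le_abs_self _).trans ?_
          rw [abs_mul]
          refine mul_le_of_le_one_left (abs_nonneg _) ?_
          rw [Matrix.sub_apply, abs_le]
          have := h01 i j
          have := h01' i j
          constructor <;> linarith
      _ ≤ (l1Norm d + l1Norm f) * l1Norm (d - f) := sum_abs_mul_sub_mul_le d f
      _ ≤ _ := mul_le_mul_of_nonneg_left (hT.l1Norm_degreeVec_sub_le h)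
          (add_nonneg (l1Norm_nonneg _) (l1Norm_nonneg _))
  have hdd' := mul_le_mul_of_nonneg_left hdd hlam
  have hopt' : objective A lam Z ≤ objective A lam Y := hopt
  rw [hsplit] at hgap
  linarith

theorem clusterDegree_pos (h : IsParam θ c B) {lam δ : ℝ} (hlam : 0 < lam)
    (hin : ∀ a : Fin r, lam < (B a a - δ) / clusterDegree θ c B a ^ 2) (a : Fin r) :
    0 < clusterDegree θ c B a := by
  refine lt_of_le_of_ne (Finset.sum_nonneg fun b _ => mul_nonneg (h.B_nonneg _ _)
    (Finset.sum_nonneg fun i _ => h.theta_nonneg i)) fun h0 => ?_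
  -- If H_a were 0, division by zero would evaluate to 0 and the condition would read lam < 0.
  have := hin a
  rw [← h0] at this
  norm_num at this
  linarith

theorem l1Norm_nodeDegree_pos (h : IsParam θ c B) (hH : ∀ a, 0 < clusterDegree θ c B a) :
    0 < l1Norm (nodeDegree θ c B) := by
  obtain ⟨i, hi⟩ := h.exists_theta_eq_one
  refine Finset.sum_pos' (fun _ _ => abs_nonneg _) ⟨i, Finset.mem_univ i, ?_⟩
  rw [nodeDegree, hi, one_mul]
  exact abs_pos.2 (hH _).ne'

theorem le_iInf_of_lt_sub_div (h : IsParam θ c B) {lam δ : ℝ} (hδ : 0 < δ)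
    (hin : ∀ a : Fin r, lam < (B a a - δ) / clusterDegree θ c B a ^ 2) :
    lam ≤ ⨅ a : Fin r, B a a / clusterDegree θ c B a ^ 2 := by
  obtain ⟨i, -⟩ := h.exists_theta_eq_one
  -- An infimum over no clusters would be 0 by convention; the node with θ = 1 provides a cluster.
  have : Nonempty (Fin r) := ⟨c i⟩
  refine le_ciInf fun a => (hin a).le.trans ?_
  gcongr
  linarith

end Deterministic

end DCSBM

/-! ### Assembly of the probabilistic and deterministic bounds. -/

theorem theorem1 :
    ∃ C₀ : ℝ, 0 < C₀ ∧
      ∀ (n r : ℕ) (θ : Fin n → ℝ) (c : Fin n → Fin r) (B : Matrix (Fin r) (Fin r) ℝ)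
        (Ω : Type*) [MeasurableSpace Ω] (μ : Measure Ω) [IsProbabilityMeasure μ]
        (G : Ω → SimpleGraph (Fin n)) (lam δ : ℝ),
        DCSBM.IsParam θ c B →
        DCSBM.IsRandomGraph θ c B μ G →
        DCSBM.DensityGap θ c B →
        0 < δ →
        0 < lam →
        (∀ a b : Fin r, a < b →
          (B a b + δ) / (DCSBM.clusterDegree θ c B a * DCSBM.clusterDegree θ c B b) < lam) →
        (∀ a : Fin r, lam < (B a a - δ) / DCSBM.clusterDegree θ c B a ^ 2) →
        0.99 - 2 * (Real.exp 1 / 2) ^ (-(2 * (n : ℤ))) ≤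
          μ.real {ω | ∀ Y : Matrix (Fin n) (Fin n) ℝ,
            DCSBM.IsSolution (DCSBM.adjacency (G ω)) lam Y →
            DCSBM.weightedL1Norm θ (DCSBM.partitionMatrix c - Y) ≤
              C₀ / δ *
                (1 + (⨅ a : Fin r, B a a / DCSBM.clusterDegree θ c B a ^ 2) *
                  DCSBM.l1Norm (DCSBM.nodeDegree θ c B)) *
                (√(n * DCSBM.l1Norm (DCSBM.nodeDegree θ c B)) + n)} := by
  -- 768 = 192 · 4, from the Grothendieck term with `radius` = 4(√(nF) + n). The degree term needs
  -- only 101 · 5 = 505.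
  refine ⟨768, by norm_num, ?_⟩
  intro n r θ c B Ω _ μ _ G lam δ h hG _ hδ hlam hout hin
  have hH := DCSBM.clusterDegree_pos h hlam hin
  have hF := DCSBM.l1Norm_nodeDegree_pos h hH
  have hinf := DCSBM.le_iInf_of_lt_sub_div h hδ hin
  have hbad₁ := DCSBM.measureReal_not_signBound_le h hG
  have hbad₂ := DCSBM.measureReal_degree_ge_le h hG hF
  set F := DCSBM.l1Norm (DCSBM.nodeDegree θ c B) with hFdef
  set m := ⨅ a : Fin r, B a a / DCSBM.clusterDegree θ c B a ^ 2
  set good := {ω | ∀ Y : Matrix (Fin n) (Fin n) ℝ,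
    DCSBM.IsSolution (DCSBM.adjacency (G ω)) lam Y →
    DCSBM.weightedL1Norm θ (DCSBM.partitionMatrix c - Y) ≤
      768 / δ * (1 + m * F) * (√(n * F) + n)} with hgood
  set bad₁ := {ω | ¬ DCSBM.SignBound (DCSBM.noise (DCSBM.adjacency (G ω)) (DCSBM.edgeProb θ c B))
    (DCSBM.radius n F)} with hb₁
  set bad₂ := {ω | 100 * F ≤ DCSBM.l1Norm (DCSBM.degreeVec (DCSBM.adjacency (G ω)))} with hb₂
  -- Covering the space and using subadditivity avoids any measurability claim about the good event,
  -- which quantifies over all matrices Y.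
  have hcover : (Set.univ : Set Ω) ⊆ good ∪ (bad₁ ∪ bad₂) := by
    intro ω _
    by_cases h₁ : ω ∈ bad₁
    · exact Or.inr (Or.inl h₁)
    by_cases h₂ : ω ∈ bad₂
    · exact Or.inr (Or.inr h₂)
    refine Or.inl fun Y hY => ?_
    have hT : DCSBM.SignBound (DCSBM.noise (DCSBM.adjacency (G ω)) (DCSBM.edgeProb θ c B))
      (DCSBM.radius n F) := not_not.1 h₁
    have hd : DCSBM.l1Norm (DCSBM.degreeVec (DCSBM.adjacency (G ω))) ≤ 100 * F :=
      (not_le.1 h₂).le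
    have key := DCSBM.IsSolution.weightedL1Norm_sub_le h hlam.le hH hout hin hY hT
    rw [← hFdef] at key
    have hs : 0 ≤ √(n * F) := Real.sqrt_nonneg _
    have hn : (0 : ℝ) ≤ n := Nat.cast_nonneg n
    rw [div_mul_eq_mul_div, div_mul_eq_mul_div, le_div_iff₀ hδ, mul_comm]
    refine key.trans ?_
    calc 192 * DCSBM.radius n F + lam *
          ((DCSBM.l1Norm (DCSBM.degreeVec (DCSBM.adjacency (G ω))) + F) * (DCSBM.radius n F + n))
        ≤ 192 * DCSBM.radius n F + m * ((100 * F + F) * (5 * (√(n * F) + n))) := by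
          have hr : DCSBM.radius n F + n ≤ 5 * (√(n * F) + n) := by
            simp only [DCSBM.radius]; linarith
          have hr0 : 0 ≤ DCSBM.radius n F + n := by simp only [DCSBM.radius]; positivity
          have hm : 0 ≤ m := hlam.le.trans hinf
          have hd0 := DCSBM.l1Norm_nonneg (DCSBM.degreeVec (DCSBM.adjacency (G ω)))
          gcongr
      _ ≤ 768 * (1 + m * F) * (√(n * F) + n) := by
          have hm : 0 ≤ m := hlam.le.trans hinf
          have : 0 ≤ m * F * (√(n * F) + n) := by positivity
          simp only [DCSBM.radius]
          nlinarith
  have h1 : (1 : ℝ) ≤ μ.real good + (μ.real bad₁ + μ.real bad₂) := by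
    calc (1 : ℝ) = μ.real Set.univ := probReal_univ.symm
      _ ≤ μ.real (good ∪ (bad₁ ∪ bad₂)) := measureReal_mono hcover
      _ ≤ μ.real good + μ.real (bad₁ ∪ bad₂) := measureReal_union_le _ _
      _ ≤ _ := by gcongr; exact measureReal_union_le _ _
  norm_num at hbad₂ ⊢
  norm_num at hbad₁
  linarith
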